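/- Let $m,p,s\in\mathbb N$, $n=ps$, and partition $X\in\mathbb R^{m\times n}$ into $p$ block vectors $X=[X_1\,|\,\cdots\,|\,X_p]$ of size $m\times s$. A *muscle* (denoted IO) is a routine which, run with machine epsilon $\varepsilon$ on $W\in\mathbb R^{m\times s}$, returns computed economic QR factors $\bar Q\in\mathbb R^{m\times s}$ and $\bar R\in\mathbb R^{s\times s}$ upper triangular. Let $c,\varepsilon_0>0$ and suppose that IO is *unconditionally stable* with a small residual: for all $0<\varepsilon\le\varepsilon_0$, every input $W$ (no restriction on its condition number) and every computed output $\bar Q,\bar R$, $$\|I_s-\bar Q^T\bar Q\|_2\le c\,\varepsilon\qquad\text{and}\qquad \|\bar Q\bar R-W\|_2\le c\,\varepsilon\,\|W\|_2 .$$ (Householder QR is the typical example.) Block modified Gram–Schmidt BMGS$\,\circ\,$IO computes $[Q_1,R_{11}]=\mathrm{IO}(X_1)$ and then, for $k=1,\dots,p-1$: sets $W=X_{k+1}$; for $j=1,\dots,k$ sets $R_{j,k+1}=Q_j^TW$ and $W\leftarrow W-Q_jR_{j,k+1}$; and finally $[Q_{k+1},R_{k+1,k+1}]=\mathrm{IO}(W)$.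 It is run in floating-point arithmetic under the standard model $\mathrm{fl}(x\ \mathrm{op}\ y)=(x\ \mathrm{op}\ y)(1+\delta)$, $|\delta|\le\varepsilon$, for each scalar operation in the matrix products and updates (sums may be evaluated in any order), and IO is run with the same $\varepsilon$. Let $\kappa(X)$ be the ratio of the largest to the smallest singular value of $X$. Then there is a constant $C>0$, depending only on $m,p,s$ and on the muscle's constants $c,\varepsilon_0$, such that for every such muscle, every $\varepsilon>0$ and every $X\in\mathbb R^{m\times n}$ of full column rank with $C\,\varepsilon\,\kappa(X)<1$, every computed factor $\bar{\mathcal Q}=[\bar Q_1\,|\,\cdots\,|\,\bar Q_p]$ of BMGS$\,\circ\,$IO satisfies $$\|I_n-\bar{\mathcal Q}^T\bar{\mathcal Q}\|_2\le C\,\varepsilon\,\kappa(X).$$ -/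

import Mathlib

open scoped Matrix Matrix.Norms.L2Operator

namespace BlockGS

/-! ### Floating-point arithmetic (standard model, machine epsilon `ε`) -/

/-- `y` is an admissible floating-point value of the exact real number `x`:
`y = x (1 + δ)` for some `|δ| ≤ ε`. -/
def Rounds (ε x y : ℝ) : Prop := ∃ δ : ℝ, |δ| ≤ ε ∧ y = x * (1 + δ)

/-- `FlSum ε t a`: the value `a` can result from adding up the numbers in `t` in floating-point
arithmetic, by pairwise additions in some order and bracketing. A sum of `N ≥ 1` numbers uses
exactly `N - 1` rounded additions. -/
inductive FlSum (ε : ℝ) : Multiset ℝ → ℝ → Prop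
  | empty : FlSum ε 0 0
  | single (x : ℝ) : FlSum ε {x} x
  | add {t u : Multiset ℝ} {a b c : ℝ} (ht : t ≠ 0) (hu : u ≠ 0)
      (ha : FlSum ε t a) (hb : FlSum ε u b) (hc : Rounds ε (a + b) c) : FlSum ε (t + u) c

/-- `C` is a floating-point value of the matrix product `A * B`: in each entry the scalar products
are rounded and then added up in floating-point arithmetic. -/
def FlMul {α β γ : Type*} [Fintype β] (ε : ℝ)
    (A : Matrix α β ℝ) (B : Matrix β γ ℝ) (C : Matrix α γ ℝ) : Prop :=
  ∀ i j, ∃ q : β → ℝ, (∀ l, Rounds ε (A i l * B l j) (q l)) ∧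
    FlSum ε (Finset.univ.val.map q) (C i j)

/-- `D` is a floating-point value of the update `W - A * B`: in each entry the scalar products are
rounded, and the entry of `W` and the negated products are added up in floating-point arithmetic
(in any order, so that first forming `A * B` and then subtracting is included). -/
def FlSubMul {α β γ : Type*} [Fintype β] (ε : ℝ)
    (W : Matrix α γ ℝ) (A : Matrix α β ℝ) (B : Matrix β γ ℝ) (D : Matrix α γ ℝ) : Prop :=
  ∀ i j, ∃ q : β → ℝ, (∀ l, Rounds ε (A i l * B l j) (q l)) ∧
    FlSum ε (W i j ::ₘ Finset.univ.val.map (fun l => -q l)) (D i j)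

/-! ### Muscles -/

/-- An intra-block orthogonalization routine (a "muscle") for `m × s` block vectors, given by its
input-output relation at each precision: `musc.computes ε W Q R` says that, run in arithmetic with
machine epsilon `ε` on the input `W`, the routine may return the computed economic QR factors
`Q` (of size `m × s`) and `R` (upper triangular, of size `s × s`). -/
structure Muscle (m s : ℕ) where
  computes : ℝ → Matrix (Fin m) (Fin s) ℝ → Matrix (Fin m) (Fin s) ℝ →
    Matrix (Fin s) (Fin s) ℝ → Prop
  upperTriangular : ∀ ε W Q R, computes ε W Q R → R.BlockTriangular id

/-- The loss of orthogonality `‖I - QᵀQ‖₂` of the routine is `O(ε)` for every input, without any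
condition on the input: it is at most `c * ε` whenever `ε ≤ ε₀`. -/
def Muscle.UnconditionallyStable {m s : ℕ} (musc : Muscle m s) (c ε₀ : ℝ) : Prop :=
  ∀ ε, 0 < ε → ε ≤ ε₀ → ∀ W Q R, musc.computes ε W Q R → ‖1 - Qᵀ * Q‖ ≤ c * ε

/-- The relative residual `‖Q R - W‖₂ / ‖W‖₂` of the routine is `O(ε)` for every input: it is at
most `c * ε` whenever `ε ≤ ε₀`. -/
def Muscle.SmallResidual {m s : ℕ} (musc : Muscle m s) (c ε₀ : ℝ) : Prop :=
  ∀ ε, 0 < ε → ε ≤ ε₀ → ∀ W Q R, musc.computes ε W Q R → ‖Q * R - W‖ ≤ c * ε * ‖W‖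

/-! ### Block modified Gram-Schmidt -/

/-- The `k`-th block vector (`m × s`) of an `m × ps` matrix; the column index `(k, j)` stands for
column `j` of block `k`. -/
def blockCol {m p s : ℕ} (X : Matrix (Fin m) (Fin p × Fin s) ℝ) (k : Fin p) :
    Matrix (Fin m) (Fin s) ℝ := X.submatrix id (Prod.mk k)

/-- The `(j, k)` block (`s × s`) of a `ps × ps` matrix. -/
def blockEntry {p s : ℕ} (R : Matrix (Fin p × Fin s) (Fin p × Fin s) ℝ) (j k : Fin p) :
    Matrix (Fin s) (Fin s) ℝ := R.submatrix (Prod.mk j) (Prod.mk k)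

/-- `Q`, `R` are possible computed outputs of BMGS ∘ musc on the input `X`, run in floating-point
arithmetic with machine epsilon `ε`. Here `V k j` is the computed content of the work block `W`
that starts as `X_k`, after its orthogonalization against the first `j` blocks `Q_0, …, Q_(j-1)`.
Blocks are counted from `0`. -/
def BMGSComputes {m p s : ℕ} (ε : ℝ) (musc : Muscle m s)
    (X Q : Matrix (Fin m) (Fin p × Fin s) ℝ)
    (R : Matrix (Fin p × Fin s) (Fin p × Fin s) ℝ) : Prop :=
  ∃ V : Fin p → ℕ → Matrix (Fin m) (Fin s) ℝ,
    (∀ k, V k 0 = blockCol X k) ∧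
    (∀ j k, j < k →
      FlMul ε (blockCol Q j)ᵀ (V k j) (blockEntry R j k) ∧
      FlSubMul ε (V k j) (blockCol Q j) (blockEntry R j k) (V k ((j : ℕ) + 1))) ∧
    (∀ k, musc.computes ε (V k k) (blockCol Q k) (blockEntry R k k)) ∧
    (∀ j k, k < j → blockEntry R j k = 0)

/-- The 2-norm condition number of a matrix of full column rank: the ratio of the largest to the
smallest singular value. Mathlib's `singularValues` is decreasing, counted from `0`. -/
noncomputable def cond {α β : Type*} [Fintype α] [Fintype β] [DecidableEq β]
    (X : Matrix α β ℝ) : ℝ :=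
  (Matrix.toEuclideanLin X).singularValues 0 /
    (Matrix.toEuclideanLin X).singularValues (Fintype.card β - 1)

end BlockGS

/-! Write `U` for the strictly block upper triangular part of `QᵀQ`. The muscle controls the
diagonal blocks of `I - QᵀQ`, and symmetry reduces the rest to bounding `U`. Right after a work
block is orthogonalized against `Q_j`, it is orthogonal to `Q_j` up to `O(ε‖X‖)`, because `Q_jᵀQ_j`
is nearly the identity (`exists_orthogonalization_step_bound`). Up to accumulated local errors, that
work block equals the part of column `k` of `QR` carried by the blocks of `Q` after `j`. The product
of `Q_jᵀ` with this part is exactly block `(j, k)` of `U R` (`blockEntry_strictUpper_mul`), so `‖U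
R‖ = O(ε‖X‖)`. The same accumulation gives `QR = X + O(ε‖X‖)`. When `εκ(X)` is small, `R` therefore
stretches every vector by at least a fixed multiple of the smallest singular value `σ` of `X`.
Cancelling `R` leaves `‖U‖ = O(ε‖X‖/σ) = O(εκ(X))`. -/

namespace LinearMap

/-! ### Extreme singular values as extreme stretching factors. -/

variable {E F : Type*} [NormedAddCommGroup E] [InnerProductSpace ℝ E] [FiniteDimensional ℝ E]
  [NormedAddCommGroup F] [InnerProductSpace ℝ F] [FiniteDimensional ℝ F]

/-- Expand `⟨x, T*T x⟩` in an orthonormal eigenbasis of `T*T`, whose eigenvalues are the squared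
singular values. -/
theorem norm_sq_apply_eq_sum_singularValues (T : E →ₗ[ℝ] F) (x : E) :
    ‖T x‖ ^ 2 = ∑ i : Fin (Module.finrank ℝ E), T.singularValues i ^ 2 *
      (T.isSymmetric_adjoint_comp_self.eigenvectorBasis rfl).repr x i ^ 2 := by
  set b := T.isSymmetric_adjoint_comp_self.eigenvectorBasis rfl
  have h1 : ‖T x‖ ^ 2 = inner ℝ x ((adjoint T ∘ₗ T) x) := by
    rw [← real_inner_self_eq_norm_sq, comp_apply, adjoint_inner_right]
  rw [h1, ← b.repr.inner_map_map, PiLp.inner_apply]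
  refine Finset.sum_congr rfl fun i _ => ?_
  rw [T.isSymmetric_adjoint_comp_self.eigenvectorBasis_apply_self_apply rfl x i,
    T.sq_singularValues_fin rfl i]
  simp [b]
  ring

theorem norm_apply_le_singularValues_zero_mul (T : E →ₗ[ℝ] F) (x : E) :
    ‖T x‖ ≤ T.singularValues 0 * ‖x‖ := by
  refine le_of_sq_le_sq ?_ (mul_nonneg (T.singularValues_nonneg 0) (norm_nonneg x))
  set b := T.isSymmetric_adjoint_comp_self.eigenvectorBasis rfl
  rw [mul_pow, ← b.repr.norm_map x, EuclideanSpace.real_norm_sq_eq, Finset.mul_sum,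
    norm_sq_apply_eq_sum_singularValues]
  gcongr with i
  · exact T.singularValues_nonneg _
  · exact T.singularValues_antitone (Nat.zero_le _)

theorem singularValues_finrank_sub_one_mul_norm_le (T : E →ₗ[ℝ] F) (x : E) :
    T.singularValues (Module.finrank ℝ E - 1) * ‖x‖ ≤ ‖T x‖ := by
  refine le_of_sq_le_sq ?_ (norm_nonneg _)
  set b := T.isSymmetric_adjoint_comp_self.eigenvectorBasis rfl
  rw [mul_pow, ← b.repr.norm_map x, EuclideanSpace.real_norm_sq_eq, Finset.mul_sum,
    norm_sq_apply_eq_sum_singularValues]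
  gcongr with i
  · exact T.singularValues_nonneg _
  · exact T.singularValues_antitone (by omega)

theorem exists_norm_apply_eq_singularValues_zero [Nontrivial E] (T : E →ₗ[ℝ] F) :
    ∃ x : E, ‖x‖ = 1 ∧ ‖T x‖ = T.singularValues 0 := by
  set b := T.isSymmetric_adjoint_comp_self.eigenvectorBasis rfl with hb
  let i : Fin (Module.finrank ℝ E) := ⟨0, Module.finrank_pos⟩
  refine ⟨b i, b.orthonormal.1 i, ?_⟩
  rw [← sq_eq_sq₀ (norm_nonneg _) (T.singularValues_nonneg 0), norm_sq_apply_eq_sum_singularValues,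
    ← hb, Finset.sum_eq_single i]
  · simp [i]
  · intro j _ hj
    simp [hj]
  · simp

end LinearMap

/-! ### Spectral norm estimates. -/

namespace Matrix

variable {α β : Type*} [Fintype α] [Fintype β] [DecidableEq β]

theorem norm_toEuclideanLin_apply_le (A : Matrix α β ℝ) (x : EuclideanSpace ℝ β) :
    ‖toEuclideanLin A x‖ ≤ ‖A‖ * ‖x‖ :=
  A.l2_opNorm_mulVec x

theorem l2_opNorm_le_of_forall {A : Matrix α β ℝ} {b : ℝ} (hb : 0 ≤ b)
    (h : ∀ x : EuclideanSpace ℝ β, ‖toEuclideanLin A x‖ ≤ b * ‖x‖) : ‖A‖ ≤ b :=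
  ContinuousLinearMap.opNorm_le_bound _ hb h

theorem l2_opNorm_transpose [DecidableEq α] (A : Matrix α β ℝ) : ‖Aᵀ‖ = ‖A‖ := by
  rw [← l2_opNorm_conjTranspose A, conjTranspose_eq_transpose_of_trivial]

theorem abs_apply_le_l2_opNorm (A : Matrix α β ℝ) (i : α) (j : β) : |A i j| ≤ ‖A‖ := by
  have h := A.norm_toEuclideanLin_apply_le (EuclideanSpace.single j 1)
  have h2 := PiLp.norm_apply_le (toEuclideanLin A (EuclideanSpace.single j 1)) i
  simpa using h2.trans h

theorem l2_opNorm_one_le : ‖(1 : Matrix β β ℝ)‖ ≤ 1 :=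
  l2_opNorm_le_of_forall zero_le_one fun x => by simp

/-- Crude passage from entries to the norm, via `‖y‖₂ ≤ ‖y‖₁`. The lost factors depend only on the
dimensions, so they disappear into the final constant. -/
theorem l2_opNorm_le_of_abs_apply_le {A : Matrix α β ℝ} {b : ℝ} (hb : 0 ≤ b)
    (h : ∀ i j, |A i j| ≤ b) : ‖A‖ ≤ Fintype.card α * Fintype.card β * b := by
  refine l2_opNorm_le_of_forall (by positivity) fun x => ?_
  have h1 (y : EuclideanSpace ℝ α) : ‖y‖ ≤ ∑ i, |y i| := by
    classical
    calc ‖y‖ = ‖∑ i, EuclideanSpace.single i (y i)‖ := by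
          congr 1; ext k; simp [Pi.single_apply]
      _ ≤ ∑ i, ‖EuclideanSpace.single i (y i)‖ := norm_sum_le _ _
      _ = ∑ i, |y i| := by simp
  calc ‖toEuclideanLin A x‖ ≤ ∑ i, |toEuclideanLin A x i| := h1 _
    _ ≤ ∑ _i : α, ∑ _j : β, b * ‖x‖ := by
      refine Finset.sum_le_sum fun i _ => ?_
      refine (Finset.abs_sum_le_sum_abs _ _).trans (Finset.sum_le_sum fun j _ => ?_)
      rw [abs_mul]
      exact mul_le_mul (h i j) (PiLp.norm_apply_le x j) (abs_nonneg _) hb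
    _ = _ := by simp; ring

theorem singularValues_zero_eq_l2_opNorm [Nonempty β] (A : Matrix α β ℝ) :
    (toEuclideanLin A).singularValues 0 = ‖A‖ := by
  refine le_antisymm ?_ (l2_opNorm_le_of_forall ((toEuclideanLin A).singularValues_nonneg 0)
    (toEuclideanLin A).norm_apply_le_singularValues_zero_mul)
  obtain ⟨x, hx, h⟩ := (toEuclideanLin A).exists_norm_apply_eq_singularValues_zero
  simpa [← h, hx] using A.norm_toEuclideanLin_apply_le x

theorem singularValues_mul_norm_le (A : Matrix α β ℝ) (x : EuclideanSpace ℝ β) :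
    (toEuclideanLin A).singularValues (Fintype.card β - 1) * ‖x‖ ≤ ‖toEuclideanLin A x‖ := by
  simpa using (toEuclideanLin A).singularValues_finrank_sub_one_mul_norm_le x

theorem singularValues_pos_of_rank_eq_card [Nonempty β] {A : Matrix α β ℝ}
    (h : A.rank = Fintype.card β) :
    0 < (toEuclideanLin A).singularValues (Fintype.card β - 1) := by
  rw [LinearMap.singularValues_pos_iff_lt_finrank_range]
  have : Module.finrank ℝ (LinearMap.range (toEuclideanLin A)) = A.rank := by
    classical
    rw [toEuclideanLin, toLpLin_eq_toLin, ← rank_eq_finrank_range_toLin]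
  rw [this, h]
  exact Nat.sub_lt Fintype.card_pos one_pos

/-- Removing a right factor `R` with `a ‖x‖ ≤ ‖R x‖` for all `x` enlarges the norm at most by the
factor `a⁻¹`. -/
theorem l2_opNorm_mul_le_of_forall_norm_le {A : Matrix α β ℝ} {R : Matrix β β ℝ} {a : ℝ}
    (ha : 0 < a) (hR : ∀ x : EuclideanSpace ℝ β, a * ‖x‖ ≤ ‖toEuclideanLin R x‖) :
    a * ‖A‖ ≤ ‖A * R‖ := by
  have hinj : Function.Injective (toEuclideanLin R) := by
    refine (injective_iff_map_eq_zero _).2 fun x hx => ?_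
    have := hR x
    rw [hx, norm_zero] at this
    exact norm_le_zero_iff.1 (nonpos_of_mul_nonpos_right this ha)
  have hsurj := LinearMap.injective_iff_surjective.1 hinj
  rw [← le_div_iff₀' ha]
  refine l2_opNorm_le_of_forall (by positivity) fun x => ?_
  obtain ⟨y, rfl⟩ := hsurj x
  have h1 : toEuclideanLin A (toEuclideanLin R y) = toEuclideanLin (A * R) y := by
    simp [toLpLin_apply, mulVec_mulVec]
  rw [h1, div_mul_eq_mul_div, le_div_iff₀ ha]
  calc ‖toEuclideanLin (A * R) y‖ * a ≤ ‖A * R‖ * ‖y‖ * a := by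
        gcongr; exact norm_toEuclideanLin_apply_le _ _
    _ = ‖A * R‖ * (a * ‖y‖) := by ring
    _ ≤ _ := by gcongr; exact hR y

end Matrix

/-! ### Rounding errors in sums, products and one orthogonalization step. -/

namespace BlockGS

/-- Induction on the summation tree, so the order plays no role. Each addition costs one factor `1 +
ε`; since the other summand is nonempty, the cardinality in the exponent grows by at least one and
absorbs it. -/
theorem FlSum.abs_sub_sum_le {ε : ℝ} (hε : 0 ≤ ε) {t : Multiset ℝ} {a : ℝ} (h : FlSum ε t a) :
    |a - t.sum| ≤ ((1 + ε) ^ t.card - 1) * (t.map abs).sum := by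
  induction h with
  | empty => simp
  | single x => simp; positivity
  | @add t u a b c ht hu _ _ hc iha ihb =>
    obtain ⟨δ, hδ, rfl⟩ := hc
    have habs (v : Multiset ℝ) : |v.sum| ≤ (v.map abs).sum := Multiset.abs_sum_le_sum_abs
    have hnn (v : Multiset ℝ) : 0 ≤ (v.map abs).sum := (abs_nonneg _).trans (habs v)
    have hgrow {v w : Multiset ℝ} (hw : w ≠ 0) :
        (1 + ε) * (1 + ε) ^ v.card ≤ (1 + ε) ^ (v.card + w.card) := by
      rw [← pow_succ']
      exact pow_le_pow_right₀ (by linarith) (by have := Multiset.card_pos.2 hw; omega)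
    have hsize {x : ℝ} {v : Multiset ℝ}
        (hx : |x - v.sum| ≤ ((1 + ε) ^ v.card - 1) * (v.map abs).sum) :
        |x| ≤ (1 + ε) ^ v.card * (v.map abs).sum := by
      have := abs_add_le (x - v.sum) v.sum
      rw [sub_add_cancel] at this
      linarith [habs v]
    have h1 : |(a + b) * δ| ≤ (|a| + |b|) * ε := by
      rw [abs_mul]; gcongr; exact abs_add_le a b
    have h2 : (a + b) * (1 + δ) - (t + u).sum = (a - t.sum) + (b - u.sum) + (a + b) * δ := by
      rw [Multiset.sum_add]; ring
    rw [h2, Multiset.card_add, Multiset.map_add, Multiset.sum_add]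
    have h3 := abs_add_three (a - t.sum) (b - u.sum) ((a + b) * δ)
    have h4 := mul_le_mul_of_nonneg_right (hgrow (v := t) hu) (hnn t)
    have h5 := mul_le_mul_of_nonneg_right (hgrow (v := u) ht) (hnn u)
    rw [add_comm u.card] at h5
    have h6 := mul_le_mul_of_nonneg_right (hsize iha) hε
    have h7 := mul_le_mul_of_nonneg_right (hsize ihb) hε
    linarith

/-- The left side is convex in `ε` and lies below its chord over `[0, 1]`. -/
theorem one_add_pow_sub_one_le {ε : ℝ} (hε : 0 ≤ ε) (hε1 : ε ≤ 1) (n : ℕ) :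
    (1 + ε) ^ n - 1 ≤ (2 ^ n - 1) * ε := by
  induction n with
  | zero => simp
  | succ n ih =>
    have h1 : (0 : ℝ) ≤ 2 ^ n - 1 := sub_nonneg.2 (one_le_pow₀ (by norm_num))
    have h2 : 0 ≤ ((2 : ℝ) ^ n - 1) * ε * (1 - ε) :=
      mul_nonneg (mul_nonneg h1 hε) (sub_nonneg.2 hε1)
    have h3 := mul_le_mul_of_nonneg_right ih (by linarith : 0 ≤ 1 + ε)
    rw [pow_succ, pow_succ]
    linarith

theorem Rounds.abs_sub_le {ε x y : ℝ} (h : Rounds ε x y) : |y - x| ≤ ε * |x| := by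
  obtain ⟨δ, hδ, rfl⟩ := h
  rw [show x * (1 + δ) - x = δ * x by ring, abs_mul]
  gcongr

theorem FlSum.abs_sub_sum_le' {ε : ℝ} (hε : 0 ≤ ε) (hε1 : ε ≤ 1) {t : Multiset ℝ} {a : ℝ}
    (h : FlSum ε t a) : |a - t.sum| ≤ 2 ^ t.card * ε * (t.map abs).sum := by
  have hnn : 0 ≤ (t.map abs).sum := (abs_nonneg _).trans Multiset.abs_sum_le_sum_abs
  refine (h.abs_sub_sum_le hε).trans (mul_le_mul_of_nonneg_right ?_ hnn)
  linarith [one_add_pow_sub_one_le hε hε1 t.card]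

theorem sum_abs_le_of_rounds {β : Type*} [Fintype β] {ε b : ℝ} (hε1 : ε ≤ 1) {x q : β → ℝ}
    (hx : ∀ l, |x l| ≤ b) (hq : ∀ l, Rounds ε (x l) (q l)) :
    ∑ l, |q l| ≤ Fintype.card β * (2 * b) := by
  refine (Finset.sum_le_card_nsmul _ _ (2 * b) fun l _ => ?_).trans (by simp)
  have h1 := (hq l).abs_sub_le
  have h2 := abs_add_le (q l - x l) (x l)
  rw [sub_add_cancel] at h2
  have h3 := mul_le_mul_of_nonneg_right hε1 (abs_nonneg (x l))
  linarith [hx l]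

theorem abs_sum_sub_sum_le_of_rounds {β : Type*} [Fintype β] {ε b : ℝ} (hε : 0 ≤ ε) {x q : β → ℝ}
    (hx : ∀ l, |x l| ≤ b) (hq : ∀ l, Rounds ε (x l) (q l)) :
    |∑ l, q l - ∑ l, x l| ≤ Fintype.card β * (ε * b) := by
  rw [← Finset.sum_sub_distrib]
  refine (Finset.abs_sum_le_sum_abs _ _).trans ?_
  refine (Finset.sum_le_card_nsmul _ _ (ε * b) fun l _ => ?_).trans (by simp)
  exact (hq l).abs_sub_le.trans (mul_le_mul_of_nonneg_left (hx l) hε)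

variable {α β γ : Type*} [Fintype α] [Fintype β] [Fintype γ] [DecidableEq β] [DecidableEq γ]

theorem abs_mul_apply_le (A : Matrix α β ℝ) (B : Matrix β γ ℝ) (i : α) (j : γ) (l : β) :
    |A i l * B l j| ≤ ‖A‖ * ‖B‖ := by
  rw [abs_mul]
  exact mul_le_mul (A.abs_apply_le_l2_opNorm i l) (B.abs_apply_le_l2_opNorm l j) (abs_nonneg _)
    (norm_nonneg _)

/-- A bound for the relative roundoff error of a product of an `α × β` and a `β × γ` matrix. -/
noncomputable def roundoff (α β γ : Type*) [Fintype α] [Fintype β] [Fintype γ] : ℝ :=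
  Fintype.card α * Fintype.card γ *
    (2 ^ (Fintype.card β + 1) * (1 + Fintype.card β * 2) + Fintype.card β)

theorem roundoff_nonneg (α β γ : Type*) [Fintype α] [Fintype β] [Fintype γ] :
    0 ≤ roundoff α β γ := by
  unfold roundoff; positivity

theorem FlMul.norm_sub_le {ε : ℝ} (hε : 0 ≤ ε) (hε1 : ε ≤ 1) {A : Matrix α β ℝ}
    {B : Matrix β γ ℝ} {C : Matrix α γ ℝ} (h : FlMul ε A B C) :
    ‖C - A * B‖ ≤ roundoff α β γ * ε * (‖A‖ * ‖B‖) := by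
  unfold roundoff
  rw [mul_assoc, mul_assoc]
  refine Matrix.l2_opNorm_le_of_abs_apply_le (by positivity) fun i j => ?_
  obtain ⟨q, hq, hsum⟩ := h i j
  have hx := abs_mul_apply_le A B i j
  have h1 := hsum.abs_sub_sum_le' hε hε1
  simp only [Multiset.map_map, Multiset.card_map, Finset.card_val, Finset.card_univ] at h1
  change |C i j - ∑ l, q l| ≤ _ * ∑ l, |q l| at h1
  have h2 := sum_abs_le_of_rounds hε1 hx hq
  have h3 := abs_sum_sub_sum_le_of_rounds hε hx hq
  have h4 := abs_sub_le (C i j) (∑ l, q l) (∑ l, A i l * B l j)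
  have h5 : 2 ^ Fintype.card β * ε * ∑ l, |q l| ≤
      2 ^ Fintype.card β * ε * (Fintype.card β * (2 * (‖A‖ * ‖B‖))) := by gcongr
  change |C i j - ∑ l, A i l * B l j| ≤ _
  -- `roundoff` is sized for the update, which has one more summand; these terms are the surplus for
  -- a plain product.
  have h6 : 0 ≤ 2 ^ Fintype.card β * ε * (Fintype.card β * (2 * (‖A‖ * ‖B‖))) := by positivity
  have h7 : 0 ≤ 2 ^ Fintype.card β * ε * (‖A‖ * ‖B‖) := by positivity
  rw [pow_succ]
  linarith

theorem FlSubMul.norm_sub_le {ε : ℝ} (hε : 0 ≤ ε) (hε1 : ε ≤ 1) {W : Matrix α γ ℝ}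
    {A : Matrix α β ℝ} {B : Matrix β γ ℝ} {D : Matrix α γ ℝ} (h : FlSubMul ε W A B D) :
    ‖D - (W - A * B)‖ ≤ roundoff α β γ * ε * (‖W‖ + ‖A‖ * ‖B‖) := by
  unfold roundoff
  rw [mul_assoc, mul_assoc]
  refine Matrix.l2_opNorm_le_of_abs_apply_le (by positivity) fun i j => ?_
  obtain ⟨q, hq, hsum⟩ := h i j
  have hx := abs_mul_apply_le A B i j
  have h1 := hsum.abs_sub_sum_le' hε hε1
  simp only [Multiset.map_cons, Multiset.map_map, Multiset.card_cons, Multiset.sum_cons,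
    Multiset.card_map, Finset.card_val, Finset.card_univ, Function.comp_def, abs_neg] at h1
  change |D i j - (W i j + ∑ l, -q l)| ≤ _ * (_ + ∑ l, |q l|) at h1
  rw [Finset.sum_neg_distrib] at h1
  have h2 := sum_abs_le_of_rounds hε1 hx hq
  have h3 := abs_sum_sub_sum_le_of_rounds hε hx hq
  have h4 := abs_sub (D i j - (W i j + -∑ l, q l)) (∑ l, q l - ∑ l, A i l * B l j)
  have hW := W.abs_apply_le_l2_opNorm i j
  have h5 : 2 ^ (Fintype.card β + 1) * ε * (|W i j| + ∑ l, |q l|) ≤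
      2 ^ (Fintype.card β + 1) * ε * (‖W‖ + Fintype.card β * (2 * (‖A‖ * ‖B‖))) := by gcongr
  change |D i j - (W i j - ∑ l, A i l * B l j)| ≤ _
  have h6 : 0 ≤ 2 ^ (Fintype.card β + 1) * ε * (Fintype.card β * (2 * ‖W‖)) := by positivity
  have h7 : 0 ≤ 2 ^ (Fintype.card β + 1) * ε * (‖A‖ * ‖B‖) := by positivity
  have h8 : 0 ≤ Fintype.card β * (ε * ‖W‖) := by positivity
  rw [show D i j - (W i j - ∑ l, A i l * B l j) =
    D i j - (W i j + -∑ l, q l) - (∑ l, q l - ∑ l, A i l * B l j) by ring]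
  linarith

/-- A factor `Q` of nearly orthonormal columns has norm at most `2`. -/
theorem norm_le_two_of_norm_one_sub_le {A : Matrix α β ℝ} (h : ‖1 - Aᵀ * A‖ ≤ 1) : ‖A‖ ≤ 2 := by
  have h1 : ‖Aᵀ * A‖ = ‖A‖ * ‖A‖ := by
    rw [← Matrix.l2_opNorm_conjTranspose_mul_self, Matrix.conjTranspose_eq_transpose_of_trivial]
  have h2 := norm_sub_le (1 : Matrix β β ℝ) (1 - Aᵀ * A)
  rw [sub_sub_cancel, h1] at h2
  nlinarith [Matrix.l2_opNorm_one_le (β := β), norm_nonneg A]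

/-- One orthogonalization step of block modified Gram-Schmidt in floating-point arithmetic. -/
theorem exists_orthogonalization_step_bound (m s : ℕ) {c : ℝ} (hc : 0 ≤ c) :
    ∃ B : ℝ, 1 ≤ B ∧ ∀ ε : ℝ, 0 ≤ ε → ε ≤ 1 → ∀ (Q V V' : Matrix (Fin m) (Fin s) ℝ)
      (R : Matrix (Fin s) (Fin s) ℝ), ‖1 - Qᵀ * Q‖ ≤ c * ε → ‖Q‖ ≤ 2 →
      FlMul ε Qᵀ V R → FlSubMul ε V Q R V' →
      ‖V' - (V - Q * R)‖ ≤ B * ε * ‖V‖ ∧ ‖Qᵀ * V'‖ ≤ B * ε * ‖V‖ ∧ ‖V'‖ ≤ B * ‖V‖ := by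
  set K := roundoff (Fin s) (Fin m) (Fin s) with hK
  set L := roundoff (Fin m) (Fin s) (Fin s) with hL
  have hK0 : 0 ≤ K := roundoff_nonneg _ _ _
  have hL0 : 0 ≤ L := roundoff_nonneg _ _ _
  set N := L * (1 + 2 * (2 + 2 * K)) with hN
  have hN0 : 0 ≤ N := by positivity
  -- The three estimates need `N`, `2c + 8K + 2N` and `5 + 4K + N`; this constant dominates all of
  -- them.
  refine ⟨5 + 8 * K + 2 * N + 2 * c, by linarith, fun ε hε hε1 Q V V' R hQ hQ2 hR hV' => ?_⟩
  have hQt : ‖Qᵀ‖ ≤ 2 := by rwa [Matrix.l2_opNorm_transpose]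
  have hV0 := norm_nonneg V
  have hE : ‖R - Qᵀ * V‖ ≤ 2 * K * (ε * ‖V‖) := by
    calc _ ≤ K * ε * (‖Qᵀ‖ * ‖V‖) := hR.norm_sub_le hε hε1
      _ ≤ K * ε * (2 * ‖V‖) := by gcongr
      _ = _ := by ring
  have hεV : ε * ‖V‖ ≤ ‖V‖ := mul_le_of_le_one_left hV0 hε1
  have hQV : ‖Qᵀ * V‖ ≤ 2 * ‖V‖ := (Matrix.l2_opNorm_mul _ _).trans (by gcongr)
  have hRV : ‖R‖ ≤ (2 + 2 * K) * ‖V‖ := by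
    have h1 := norm_add_le (R - Qᵀ * V) (Qᵀ * V)
    rw [sub_add_cancel] at h1
    have h2 := mul_le_mul_of_nonneg_left hεV (by positivity : 0 ≤ 2 * K)
    linarith
  have hF : ‖V' - (V - Q * R)‖ ≤ N * (ε * ‖V‖) := by
    calc _ ≤ L * ε * (‖V‖ + ‖Q‖ * ‖R‖) := hV'.norm_sub_le hε hε1
      _ ≤ L * ε * (‖V‖ + 2 * ((2 + 2 * K) * ‖V‖)) := by gcongr
      _ = _ := by rw [hN]; ring
  have hεV0 : 0 ≤ ε * ‖V‖ := by positivity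
  have hKV := mul_nonneg hK0 hεV0
  have hNV := mul_nonneg hN0 hεV0
  have hcV := mul_nonneg hc hεV0
  refine ⟨by linarith, ?_, ?_⟩
  · have h1 : Qᵀ * V' = (1 - Qᵀ * Q) * (Qᵀ * V) - Qᵀ * (Q * (R - Qᵀ * V)) +
        Qᵀ * (V' - (V - Q * R)) := by
      simp only [Matrix.sub_mul, Matrix.mul_sub, Matrix.one_mul, Matrix.mul_assoc]
      abel
    have h2 : ‖(1 - Qᵀ * Q) * (Qᵀ * V)‖ ≤ c * ε * (2 * ‖V‖) :=
      (Matrix.l2_opNorm_mul _ _).trans (by gcongr)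
    have h3 : ‖Qᵀ * (Q * (R - Qᵀ * V))‖ ≤ 2 * (2 * (2 * K * (ε * ‖V‖))) := by
      refine (Matrix.l2_opNorm_mul _ _).trans ?_
      gcongr
      exact (Matrix.l2_opNorm_mul _ _).trans (by gcongr)
    have h4 : ‖Qᵀ * (V' - (V - Q * R))‖ ≤ 2 * (N * (ε * ‖V‖)) :=
      (Matrix.l2_opNorm_mul _ _).trans (by gcongr)
    rw [h1]
    refine (norm_add_le _ _).trans ?_
    have h5 := norm_sub_le ((1 - Qᵀ * Q) * (Qᵀ * V)) (Qᵀ * (Q * (R - Qᵀ * V)))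
    linarith
  · have h1 : V' = (V' - (V - Q * R)) + V - Q * R := by abel
    have h2 : ‖Q * R‖ ≤ 2 * ((2 + 2 * K) * ‖V‖) :=
      (Matrix.l2_opNorm_mul _ _).trans (by gcongr)
    have h3 := norm_sub_le ((V' - (V - Q * R)) + V) (Q * R)
    have h4 := norm_add_le (V' - (V - Q * R)) V
    rw [← h1] at h3
    have h5 := mul_le_mul_of_nonneg_left hεV hN0
    have h6 := mul_nonneg hK0 hV0
    have h7 := mul_nonneg hN0 hV0
    have h8 := mul_nonneg hc hV0
    linarith

/-! ### Block decomposition of `QR` and of the Gram matrix. -/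

variable {m p s : ℕ}

theorem norm_blockCol_le (X : Matrix (Fin m) (Fin p × Fin s) ℝ) (k : Fin p) :
    ‖blockCol X k‖ ≤ m * s * ‖X‖ := by
  simpa using Matrix.l2_opNorm_le_of_abs_apply_le (A := blockCol X k) (norm_nonneg X)
    fun i j => X.abs_apply_le_l2_opNorm i (k, j)

theorem norm_le_of_norm_blockCol_le {X : Matrix (Fin m) (Fin p × Fin s) ℝ} {b : ℝ} (hb : 0 ≤ b)
    (h : ∀ k, ‖blockCol X k‖ ≤ b) : ‖X‖ ≤ m * (p * s) * b := by
  simpa using Matrix.l2_opNorm_le_of_abs_apply_le (A := X) hb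
    fun i j => ((blockCol X j.1).abs_apply_le_l2_opNorm i j.2).trans (h j.1)

theorem norm_le_of_norm_blockEntry_le {R : Matrix (Fin p × Fin s) (Fin p × Fin s) ℝ} {b : ℝ}
    (hb : 0 ≤ b) (h : ∀ j k, ‖blockEntry R j k‖ ≤ b) : ‖R‖ ≤ (p * s) * (p * s) * b := by
  simpa using Matrix.l2_opNorm_le_of_abs_apply_le (A := R) hb
    fun i j => ((blockEntry R i.1 j.1).abs_apply_le_l2_opNorm i.2 j.2).trans (h i.1 j.1)

theorem blockCol_mul (Q : Matrix (Fin m) (Fin p × Fin s) ℝ)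
    (R : Matrix (Fin p × Fin s) (Fin p × Fin s) ℝ) (k : Fin p) :
    blockCol (Q * R) k = ∑ i, blockCol Q i * blockEntry R i k := by
  ext a b
  simp [blockCol, blockEntry, Matrix.mul_apply, Matrix.sum_apply, Fintype.sum_prod_type]

/-- The part of `Q * R` in block column `k` that is due to the blocks of `Q` from `j` on. -/
noncomputable def tailSum (Q : Matrix (Fin m) (Fin p × Fin s) ℝ)
    (R : Matrix (Fin p × Fin s) (Fin p × Fin s) ℝ) (k : Fin p) (j : ℕ) :
    Matrix (Fin m) (Fin s) ℝ :=
  ∑ i : Fin p, if j ≤ i then blockCol Q i * blockEntry R i k else 0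

theorem tailSum_zero (Q : Matrix (Fin m) (Fin p × Fin s) ℝ)
    (R : Matrix (Fin p × Fin s) (Fin p × Fin s) ℝ) (k : Fin p) :
    tailSum Q R k 0 = blockCol (Q * R) k := by
  simp [tailSum, blockCol_mul]

theorem tailSum_val (Q : Matrix (Fin m) (Fin p × Fin s) ℝ)
    (R : Matrix (Fin p × Fin s) (Fin p × Fin s) ℝ) (k j : Fin p) :
    tailSum Q R k j = blockCol Q j * blockEntry R j k + tailSum Q R k (j + 1) := by
  unfold tailSum
  rw [← Fintype.sum_ite_eq' j (fun i => blockCol Q i * blockEntry R i k),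
    ← Finset.sum_add_distrib]
  refine Finset.sum_congr rfl fun i _ => ?_
  rcases lt_trichotomy i j with h | h | h
  · have h1 : ¬ (j : ℕ) ≤ i := by simpa using h
    rw [if_neg h1, if_neg h.ne, if_neg (by omega), add_zero]
  · subst h
    simp
  · have h1 : (j : ℕ) + 1 ≤ i := h
    rw [if_pos (by omega), if_neg h.ne', if_pos h1, zero_add]

theorem tailSum_eq_zero (Q : Matrix (Fin m) (Fin p × Fin s) ℝ)
    {R : Matrix (Fin p × Fin s) (Fin p × Fin s) ℝ} (hR : ∀ j k, k < j → blockEntry R j k = 0)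
    {k : Fin p} {j : ℕ} (hj : k < j) : tailSum Q R k j = 0 := by
  refine Finset.sum_eq_zero fun i _ => ?_
  split_ifs with h
  · rw [hR i k (hj.trans_le h), Matrix.mul_zero]
  · rfl

/-- The strictly block upper triangular part of a matrix. -/
def strictUpper (A : Matrix (Fin p × Fin s) (Fin p × Fin s) ℝ) :
    Matrix (Fin p × Fin s) (Fin p × Fin s) ℝ :=
  Matrix.of fun i k => if i.1 < k.1 then A i k else 0

/-- Block row `j` of the strict upper part keeps only the terms `Q_jᵀ Q_i R_ik` with `i > j`. This
identity turns the stepwise orthogonality of the algorithm into a statement about one matrix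
product. -/
theorem blockEntry_strictUpper_mul (Q : Matrix (Fin m) (Fin p × Fin s) ℝ)
    (R : Matrix (Fin p × Fin s) (Fin p × Fin s) ℝ) (j k : Fin p) :
    blockEntry (strictUpper (Qᵀ * Q) * R) j k = (blockCol Q j)ᵀ * tailSum Q R k (j + 1) := by
  unfold tailSum
  rw [Matrix.mul_sum]
  ext a b
  rw [Matrix.sum_apply]
  simp only [blockEntry, Matrix.submatrix_apply, Matrix.mul_apply, Fintype.sum_prod_type,
    strictUpper, Matrix.of_apply]
  refine Finset.sum_congr rfl fun i _ => ?_
  by_cases h : j < i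
  · have h1 : (j : ℕ) + 1 ≤ i := h
    rw [if_pos h1]
    change _ = ((blockCol Q j)ᵀ * (blockCol Q i * blockEntry R i k)) a b
    rw [← Matrix.mul_assoc]
    simp [h, Matrix.mul_apply, blockCol, blockEntry]
  · have h1 : ¬ (j : ℕ) + 1 ≤ i := h
    rw [if_neg h1]
    simp [h]

/-- By symmetry of the Gram matrix, every entry off the diagonal blocks occurs, up to sign, in the
strict upper part. -/
theorem norm_one_sub_transpose_mul_self_le (Q : Matrix (Fin m) (Fin p × Fin s) ℝ) {d : ℝ}
    (hd : 0 ≤ d) (hQ : ∀ k, ‖1 - (blockCol Q k)ᵀ * blockCol Q k‖ ≤ d) :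
    ‖1 - Qᵀ * Q‖ ≤ (p * s) * (p * s) * (d + ‖strictUpper (Qᵀ * Q)‖) := by
  have key (i k : Fin p × Fin s) (h : i.1 < k.1) :
      |(1 - Qᵀ * Q : Matrix _ _ ℝ) i k| ≤ ‖strictUpper (Qᵀ * Q)‖ := by
    have h1 := (strictUpper (Qᵀ * Q)).abs_apply_le_l2_opNorm i k
    have h2 : i ≠ k := fun e => h.ne (congrArg Prod.fst e)
    simpa [strictUpper, h, Matrix.one_apply_ne h2] using h1
  have hsymm (i k : Fin p × Fin s) : (1 - Qᵀ * Q : Matrix _ _ ℝ) i k = (1 - Qᵀ * Q : Matrix _ _ ℝ) k i := by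
    simp [Matrix.mul_apply, Matrix.one_apply, mul_comm, eq_comm]
  have hU := norm_nonneg (strictUpper (Qᵀ * Q))
  have := Matrix.l2_opNorm_le_of_abs_apply_le (A := 1 - Qᵀ * Q)
    (b := d + ‖strictUpper (Qᵀ * Q)‖) (by positivity) fun i k => ?_
  · simpa using this
  rcases lt_trichotomy i.1 k.1 with h | h | h
  · linarith [key i k h]
  · have h1 := ((1 - (blockCol Q i.1)ᵀ * blockCol Q i.1).abs_apply_le_l2_opNorm i.2 k.2).trans
      (hQ i.1)
    have h2 : (1 - (blockCol Q i.1)ᵀ * blockCol Q i.1 : Matrix _ _ ℝ) i.2 k.2 = (1 - Qᵀ * Q : Matrix _ _ ℝ) i k := by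
      simp [Matrix.mul_apply, Matrix.one_apply, blockCol, Prod.ext_iff, h]
      rw [← h]
    rw [h2] at h1
    linarith
  · rw [hsymm]
    linarith [key k i h]

/-- Local errors at most `η` in the updates, in the orthogonality of the updated blocks to the
preceding block of `Q`, and in the block factorizations. -/
structure LocalErrors (X Q : Matrix (Fin m) (Fin p × Fin s) ℝ)
    (R : Matrix (Fin p × Fin s) (Fin p × Fin s) ℝ)
    (V : Fin p → ℕ → Matrix (Fin m) (Fin s) ℝ) (η : ℝ) : Prop where
  nonneg : 0 ≤ η
  start : ∀ k, V k 0 = blockCol X k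
  update : ∀ j k : Fin p, j < k →
    ‖V k (j + 1) - (V k j - blockCol Q j * blockEntry R j k)‖ ≤ η
  orthogonal : ∀ j k : Fin p, j < k → ‖(blockCol Q j)ᵀ * V k (j + 1)‖ ≤ η
  factor : ∀ k, ‖blockCol Q k * blockEntry R k k - V k k‖ ≤ η
  triangular : ∀ j k, k < j → blockEntry R j k = 0

/-! ### Accumulation of local errors. -/

namespace LocalErrors

variable {X Q : Matrix (Fin m) (Fin p × Fin s) ℝ} {R : Matrix (Fin p × Fin s) (Fin p × Fin s) ℝ}
  {V : Fin p → ℕ → Matrix (Fin m) (Fin s) ℝ} {η : ℝ}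

/-- Descending induction on `j`: at `j = k` only the factorization error is present, and each step
down adds one update error. That makes `k - j + 1 ≤ p - j` errors in all. -/
theorem norm_tailSum_sub_le_sub_mul (h : LocalErrors X Q R V η) (k : Fin p) {j : ℕ} (hj : j ≤ k) :
    ‖tailSum Q R k j - V k j‖ ≤ (p - j) * η := by
  induction hj using Nat.decreasingInduction with
  | self =>
    rw [tailSum_val, tailSum_eq_zero Q h.triangular (Nat.lt_succ_self _), add_zero]
    have h1 : (k : ℝ) + 1 ≤ p := by exact_mod_cast k.2
    have h2 := h.nonneg
    have h3 := h.factor k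
    nlinarith
  | of_succ j hj ih =>
    have hjp : j < p := hj.trans k.2
    have h1 := h.update ⟨j, hjp⟩ k hj
    have h2 := tailSum_val Q R k ⟨j, hjp⟩
    simp only at h1 h2
    have h3 : tailSum Q R k j - V k j = (tailSum Q R k (j + 1) - V k (j + 1)) +
        (V k (j + 1) - (V k j - blockCol Q ⟨j, hjp⟩ * blockEntry R ⟨j, hjp⟩ k)) := by
      rw [h2]; abel
    rw [h3]
    refine (norm_add_le _ _).trans ?_
    push_cast at ih
    linarith

theorem norm_tailSum_sub_le (h : LocalErrors X Q R V η) (k : Fin p) {j : ℕ} (hj : j ≤ k) :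
    ‖tailSum Q R k j - V k j‖ ≤ p * η := by
  refine (h.norm_tailSum_sub_le_sub_mul k hj).trans ?_
  have := h.nonneg
  gcongr
  simp

theorem norm_mul_sub_le (h : LocalErrors X Q R V η) : ‖Q * R - X‖ ≤ m * (p * s) * (p * η) := by
  have := h.nonneg
  refine norm_le_of_norm_blockCol_le (by positivity) fun k => ?_
  have h1 := h.norm_tailSum_sub_le k (Nat.zero_le k)
  rwa [tailSum_zero, h.start] at h1

/-- Orthogonality to `Q_j` is used only immediately after step `j`, while it is still accurate. It
passes to the tail sum because that differs from the work block by accumulated errors alone. -/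
theorem norm_strictUpper_mul_le (h : LocalErrors X Q R V η) (hQ : ∀ k, ‖blockCol Q k‖ ≤ 2) :
    ‖strictUpper (Qᵀ * Q) * R‖ ≤ (p * s) * (p * s) * (2 * (p * η) + η) := by
  have hη := h.nonneg
  refine norm_le_of_norm_blockEntry_le (by positivity) fun j k => ?_
  rw [blockEntry_strictUpper_mul]
  rcases lt_or_ge j k with hjk | hjk
  · have h1 := h.norm_tailSum_sub_le k (j := j + 1) hjk
    have h2 : (blockCol Q j)ᵀ * tailSum Q R k (j + 1) =
        (blockCol Q j)ᵀ * (tailSum Q R k (j + 1) - V k (j + 1)) +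
          (blockCol Q j)ᵀ * V k (j + 1) := by
      rw [← Matrix.mul_add, sub_add_cancel]
    rw [h2]
    refine (norm_add_le _ _).trans (add_le_add ?_ (h.orthogonal j k hjk))
    refine (Matrix.l2_opNorm_mul _ _).trans ?_
    rw [Matrix.l2_opNorm_transpose]
    exact mul_le_mul (hQ j) h1 (norm_nonneg _) zero_le_two
  · have h1 : (k : ℕ) < j + 1 := Nat.lt_succ_of_le hjk
    rw [tailSum_eq_zero Q h.triangular h1, Matrix.mul_zero, norm_zero]
    positivity

end LocalErrors

/-! ### From a floating-point run to local errors, and the final estimate. -/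

/-- Rounding errors are relative to the current work block. Each step enlarges that block by at most
a factor `B`, so over at most `p` steps they become errors relative to `X`. -/
theorem exists_localErrors (m p s : ℕ) {c : ℝ} (hc : 0 ≤ c) :
    ∃ K : ℝ, 0 ≤ K ∧ ∀ {ε ε₀ : ℝ} {musc : Muscle m s}, musc.UnconditionallyStable c ε₀ →
      musc.SmallResidual c ε₀ → 0 < ε → ε ≤ ε₀ → ε ≤ 1 → c * ε ≤ 1 →
      ∀ {X Q : Matrix (Fin m) (Fin p × Fin s) ℝ} {R : Matrix (Fin p × Fin s) (Fin p × Fin s) ℝ},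
      BMGSComputes ε musc X Q R →
      (∀ k, ‖1 - (blockCol Q k)ᵀ * blockCol Q k‖ ≤ c * ε) ∧ (∀ k, ‖blockCol Q k‖ ≤ 2) ∧
      ∃ V, LocalErrors X Q R V (K * (ε * ‖X‖)) := by
  obtain ⟨B, hB, hstep⟩ := exists_orthogonalization_step_bound m s hc
  have hB0 : 0 ≤ B := zero_le_one.trans hB
  refine ⟨(B + c) * (B ^ p * (m * s)), by positivity, ?_⟩
  rintro ε ε₀ musc hst hres hε hε₀ hε1 hcε X Q R ⟨V, hV0, hV, hmusc, hR⟩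
  have hQ1 (k) : ‖1 - (blockCol Q k)ᵀ * blockCol Q k‖ ≤ c * ε := hst ε hε hε₀ _ _ _ (hmusc k)
  have hQ2 (k) : ‖blockCol Q k‖ ≤ 2 := norm_le_two_of_norm_one_sub_le ((hQ1 k).trans hcε)
  have hs (j k : Fin p) (hjk : j < k) :=
    hstep ε hε.le hε1 _ _ _ _ (hQ1 j) (hQ2 j) (hV j k hjk).1 (hV j k hjk).2
  have hpow (k : Fin p) (j : ℕ) (hj : j ≤ k) : ‖V k j‖ ≤ B ^ j * (m * s * ‖X‖) := by
    induction j with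
    | zero => simpa [hV0] using norm_blockCol_le X k
    | succ j ih =>
      have h1 := (hs ⟨j, by omega⟩ k hj).2.2
      have h2 := mul_le_mul_of_nonneg_left (ih (by omega)) hB0
      rw [pow_succ']
      simp only at h1
      linarith
  have hVn (k : Fin p) (j : ℕ) (hj : j ≤ k) : ‖V k j‖ ≤ B ^ p * (m * s) * ‖X‖ := by
    refine (hpow k j hj).trans ?_
    rw [mul_assoc (B ^ p)]
    gcongr
    omega
  have hη (k : Fin p) (j : ℕ) (hj : j ≤ k) {a : ℝ} (ha : 0 ≤ a) (haB : a ≤ B + c) :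
      a * ε * ‖V k j‖ ≤ (B + c) * (B ^ p * (m * s)) * (ε * ‖X‖) := by
    calc _ ≤ (B + c) * ε * (B ^ p * (m * s) * ‖X‖) := by
          gcongr
          exact hVn k j hj
      _ = _ := by ring
  have hBc : B ≤ B + c := by linarith
  have hcB : c ≤ B + c := by linarith
  exact ⟨hQ1, hQ2, V, by positivity, hV0,
    fun j k hjk => (hs j k hjk).1.trans (hη k j hjk.le hB0 hBc),
    fun j k hjk => (hs j k hjk).2.1.trans (hη k j hjk.le hB0 hBc),
    fun k => (hres ε hε hε₀ _ _ _ (hmusc k)).trans (hη k k le_rfl hc hcB), hR⟩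

theorem cond_nonneg {α β : Type*} [Fintype α] [Fintype β] [DecidableEq β] (X : Matrix α β ℝ) :
    0 ≤ cond X :=
  div_nonneg (LinearMap.singularValues_nonneg _ _) (LinearMap.singularValues_nonneg _ _)

end BlockGS

/-- Loss of orthogonality of BMGS composed with an unconditionally stable muscle: the constant
`C` depends only on the dimensions and on the constants `c`, `ε₀` in the `O(ε)` of the muscle. -/
theorem mainTheorem2 (m p s : ℕ) (c ε₀ : ℝ) (hc : 0 < c) (hε₀ : 0 < ε₀) :
    ∃ C : ℝ, 0 < C ∧
      ∀ musc : BlockGS.Muscle m s, musc.UnconditionallyStable c ε₀ → musc.SmallResidual c ε₀ →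
      ∀ ε : ℝ, 0 < ε →
      ∀ X : Matrix (Fin m) (Fin p × Fin s) ℝ, X.rank = p * s →
        C * ε * BlockGS.cond X < 1 →
      ∀ (Q : Matrix (Fin m) (Fin p × Fin s) ℝ)
        (R : Matrix (Fin p × Fin s) (Fin p × Fin s) ℝ),
        BlockGS.BMGSComputes ε musc X Q R →
        ‖1 - Qᵀ * Q‖ ≤ C * ε * BlockGS.cond X := by
  obtain ⟨K, hK, hloc⟩ := BlockGS.exists_localErrors m p s hc.le
  set K₁ : ℝ := m * (p * s) * (p * K) with hK₁
  set K₂ : ℝ := (p * s) * (p * s) * (2 * (p * K) + K) with hK₂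
  -- A bound for `‖Q‖`, with `1` added so that division by `q` is safe even in degenerate
  -- dimensions.
  set q : ℝ := m * (p * s) * 2 + 1 with hq
  set M : ℝ := (p * s) * (p * s) * (c + 2 * q * K₂) with hM
  have hK₁0 : 0 ≤ K₁ := by positivity
  have hK₂0 : 0 ≤ K₂ := by positivity
  have hq0 : 0 < q := by positivity
  have hM0 : 0 ≤ M := by positivity
  have hε₀' : 0 < ε₀⁻¹ := inv_pos.2 hε₀
  -- `M` is the constant of the final bound. Through `C * ε * κ < 1` and `κ ≥ 1`, the other terms
  -- ensure in turn that the residual is at most `σ / 2` and that `ε ≤ ε₀`, `ε ≤ 1` and `c * ε ≤ 1`.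
  refine ⟨M + 2 * K₁ + ε₀⁻¹ + 1 + c, by positivity, ?_⟩
  intro musc hst hres ε hε X hX hlt Q R hBMGS
  have hκ0 := BlockGS.cond_nonneg X
  rcases isEmpty_or_nonempty (Fin p × Fin s) with hemp | hne
  · rw [Subsingleton.elim (1 - Qᵀ * Q) 0, norm_zero]
    positivity
  set σ := (Matrix.toEuclideanLin X).singularValues (Fintype.card (Fin p × Fin s) - 1) with hσ
  have hσ0 : 0 < σ := Matrix.singularValues_pos_of_rank_eq_card (by simpa using hX)
  set κ := BlockGS.cond X with hκ
  -- This converts every error `ε‖X‖` into `εκσ`, which is comparable with the smallest singular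
  -- value.
  have hκσ : κ * σ = ‖X‖ := by
    rw [hκ, BlockGS.cond, Matrix.singularValues_zero_eq_l2_opNorm, ← hσ,
      div_mul_cancel₀ _ hσ0.ne']
  have hκ1 : 1 ≤ κ := by
    rw [hκ, BlockGS.cond, ← hσ, one_le_div hσ0]
    exact LinearMap.singularValues_antitone _ (Nat.zero_le _)
  have hεκ : 0 < ε * κ := by positivity
  have hεle : ε ≤ ε * κ := le_mul_of_one_le_right hε.le hκ1
  have hsmall {a : ℝ} (ha : a ≤ M + 2 * K₁ + ε₀⁻¹ + 1 + c) : a * (ε * κ) < 1 := by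
    have := mul_le_mul_of_nonneg_right ha hεκ.le
    linarith
  have hε1 : ε ≤ 1 := by linarith [hsmall (a := 1) (by linarith)]
  have hcε : c * ε ≤ 1 := by
    linarith [hsmall (a := c) (by linarith), mul_le_mul_of_nonneg_left hεle hc.le]
  have hεε₀ : ε ≤ ε₀ := by
    have h1 := hsmall (a := ε₀⁻¹) (by linarith)
    rw [inv_mul_lt_one₀ hε₀] at h1
    linarith
  obtain ⟨hQ1, hQ2, V, hV⟩ := hloc hst hres hε hεε₀ hε1 hcε hBMGS
  have hres1 : ‖Q * R - X‖ ≤ K₁ * (ε * κ) * σ := by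
    refine hV.norm_mul_sub_le.trans_eq ?_
    rw [hK₁, ← hκσ]; ring
  have hUR : ‖BlockGS.strictUpper (Qᵀ * Q) * R‖ ≤ K₂ * (ε * κ) * σ := by
    refine (hV.norm_strictUpper_mul_le hQ2).trans_eq ?_
    rw [hK₂, ← hκσ]; ring
  have hQn : ‖Q‖ ≤ q := by
    linarith [BlockGS.norm_le_of_norm_blockCol_le zero_le_two hQ2]
  -- From `X = QR - (QR - X)`: `σ‖x‖ ≤ ‖Xx‖ ≤ q‖Rx‖ + (σ/2)‖x‖`, and the last term is absorbed on
  -- the left.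
  have hR (x : EuclideanSpace ℝ (Fin p × Fin s)) :
      σ / (2 * q) * ‖x‖ ≤ ‖Matrix.toEuclideanLin R x‖ := by
    have h1 := X.singularValues_mul_norm_le x
    rw [← hσ] at h1
    have h2 : Matrix.toEuclideanLin X x = Matrix.toEuclideanLin Q (Matrix.toEuclideanLin R x) -
        Matrix.toEuclideanLin (Q * R - X) x := by
      simp [Matrix.toLpLin_apply, Matrix.mulVec_mulVec]
    have h3 := (Q * R - X).norm_toEuclideanLin_apply_le x
    have h4 := Q.norm_toEuclideanLin_apply_le (Matrix.toEuclideanLin R x)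
    have h5 := norm_sub_le (Matrix.toEuclideanLin Q (Matrix.toEuclideanLin R x))
      (Matrix.toEuclideanLin (Q * R - X) x)
    rw [← h2] at h5
    have h6 := mul_le_mul_of_nonneg_right hQn (norm_nonneg (Matrix.toEuclideanLin R x))
    have h7 : 2 * K₁ * (ε * κ) * (σ * ‖x‖) ≤ 1 * (σ * ‖x‖) := by
      gcongr
      exact (hsmall (by linarith)).le
    have h8 := mul_le_mul_of_nonneg_right hres1 (norm_nonneg x)
    rw [div_mul_eq_mul_div, div_le_iff₀ (by positivity)]
    linarith
  have hU : ‖BlockGS.strictUpper (Qᵀ * Q)‖ ≤ 2 * q * K₂ * (ε * κ) := by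
    -- Cancelling `R` costs the factor `2q/σ`, whose `σ` cancels the one in the bound for `U R`.
    have h1 := (Matrix.l2_opNorm_mul_le_of_forall_norm_le (A := BlockGS.strictUpper (Qᵀ * Q))
      (by positivity) hR).trans hUR
    rw [div_mul_eq_mul_div, div_le_iff₀ (by positivity)] at h1
    refine le_of_mul_le_mul_left (h1.trans_eq ?_) hσ0
    ring
  calc ‖1 - Qᵀ * Q‖ ≤ (p * s) * (p * s) * (c * ε + ‖BlockGS.strictUpper (Qᵀ * Q)‖) :=
        BlockGS.norm_one_sub_transpose_mul_self_le Q (by positivity) hQ1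
    _ ≤ (p * s) * (p * s) * (c * (ε * κ) + 2 * q * K₂ * (ε * κ)) := by gcongr
    _ = M * (ε * κ) := by rw [hM]; ring
    _ ≤ (M + 2 * K₁ + ε₀⁻¹ + 1 + c) * (ε * κ) := by
        gcongr
        linarith
    _ = _ := by ring
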